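/- Let $L>0$, let $t_1<t_2$ be real numbers and let $\varepsilon>0$. Write $\Omega=\mathbb{R}\times(-L,L)$, with points $(t,x)$; functions are real-valued, and supports are taken relative to $\Omega$ (the support of $u\in L^2(\Omega)$ is the complement in $\Omega$ of the largest open subset of $\Omega$ on which $u=0$ almost everywhere). There is a constant $C>0$, depending only on $L,t_1,t_2,\varepsilon$, such that for every $f\in L^2(\Omega)$ with $\operatorname{supp} f\subset[t_1,t_2]\times(-L,L)$ there exists $v\in L^2(\Omega)$ satisfying $$v_t-v_{xx}+v_{xxx}=f\quad\text{in }\mathcal{D}'(\Omega),\qquad \operatorname{supp} v\subset[t_1-\varepsilon,t_2+\varepsilon]\times(-L,L),\qquad \|v\|_{L^2(\Omega)}\le C\,\|f\|_{L^2(\Omega)}.$$ -/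

import Mathlib

open MeasureTheory TopologicalSpace Topology
open scoped ENNReal Distributions LineDeriv

namespace KdVBurgers

/-- The open strip `ℝ × (-L, L)` in the `(t, x)`-plane. -/
def strip (L : ℝ) : Opens (ℝ × ℝ) :=
  ⟨Set.univ ×ˢ Set.Ioo (-L) L, isOpen_univ.prod isOpen_Ioo⟩

/-- The real Hilbert space `L²(Ω)` with respect to Lebesgue measure. -/
abbrev L2 (Ω : Opens (ℝ × ℝ)) : Type :=
  Lp ℝ 2 ((volume : Measure (ℝ × ℝ)).restrict (Ω : Set (ℝ × ℝ)))

/-- The support in `Ω` of (the class of) a function `u` on `Ω`: the complement in `Ω` of the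
largest open subset of `Ω` on which `u` vanishes almost everywhere. -/
def supportIn (Ω : Opens (ℝ × ℝ)) (u : ℝ × ℝ → ℝ) : Set (ℝ × ℝ) :=
  {z | z ∈ Ω ∧ ∀ U ∈ 𝓝 z,
    ¬ ∀ᵐ w ∂((volume : Measure (ℝ × ℝ)).restrict (Ω : Set (ℝ × ℝ))), w ∈ U → u w = 0}

/-- The distribution `φ ↦ ∫_Ω φ u` on `Ω` defined by `u ∈ L²(Ω)`. -/
noncomputable def toDistribution {Ω : Opens (ℝ × ℝ)} (u : L2 Ω) : 𝓓'(Ω, ℝ) :=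
  (TestFunction.integralAgainstBilinCLM (ContinuousLinearMap.mul ℝ ℝ)
    ((volume : Measure (ℝ × ℝ)).restrict (Ω : Set (ℝ × ℝ))) u : 𝓓(Ω, ℝ) →L[ℝ] ℝ)

theorem toDistribution_apply {Ω : Opens (ℝ × ℝ)} (u : L2 Ω) (φ : 𝓓(Ω, ℝ)) :
    toDistribution u φ = ∫ z in (Ω : Set (ℝ × ℝ)), φ z * u z := by
  have h : LocallyIntegrable u
      ((volume : Measure (ℝ × ℝ)).restrict (Ω : Set (ℝ × ℝ))) :=
    (Lp.memLp u).locallyIntegrable (by norm_num)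
  exact TestFunction.integralAgainstBilinCLM_eq_integral (h.locallyIntegrableOn _)

/-- The operator `P = ∂_t - ∂_x² + ∂_x³` on distributions on an open set of the `(t, x)`-plane;
`∂_t` and `∂_x` are the distributional derivatives along `(1, 0)` and `(0, 1)`. -/
noncomputable def P {Ω : Opens (ℝ × ℝ)} (T : 𝓓'(Ω, ℝ)) : 𝓓'(Ω, ℝ) :=
  ∂_{((1, 0) : ℝ × ℝ)} T
    - ∂_{((0, 1) : ℝ × ℝ)} (∂_{((0, 1) : ℝ × ℝ)} T)
    + ∂_{((0, 1) : ℝ × ℝ)} (∂_{((0, 1) : ℝ × ℝ)} (∂_{((0, 1) : ℝ × ℝ)} T))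

end KdVBurgers

namespace KdVBurgers

/-! The proof is by duality. Up to sign the transpose of `P` is `adj` = `∂_t + ∂_x² + ∂_x³`, so a
solution `v` supported in the larger slab exists with norm control as soon as every test function
`φ` on the strip satisfies `‖φ‖ ≤ √C ‖adj φ‖`, the left norm over `[t₁, t₂]` and the right one over
`[t₁ - ε, t₂ + ε]` (`observability`). The functional `adj φ ↦ -∫ f φ` is then well defined and
bounded, and Hahn–Banach and Riesz represent it (`exists_inner_eq_of_abs_le`). No boundary condition
is imposed on `v`, so compactly supported `φ` suffice.

Observability is a Carleman estimate. Put `y = 2L - x`, which lies in `[L, 3L]` on the closed strip,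
and `ψ = 5L² - y²/2`, so that `ψ_x = y`, `ψ_xx = -1` and `ψ ≥ L²/2`. Set `q = exp(-(m(t) ψ(x) - x/3
- 2t/27)) φ`. The factor `exp(x/3 + 2t/27)` turns `adj` into `∂_t + ∂_x³ - ∂_x/3`, removing the
second-order term. Conjugation by `exp(-mψ)` then gives `S + K` with `S` formally symmetric and `K`
formally skew. In `(S q + K q)² = (S q)² + (K q)² + 2 (S q)(K q)` the cross term is a time
derivative plus a space derivative plus a quadratic form in `q, q_x, q_xx`, positive when `m` is
large and `m'`, `m''` are controlled by `m²`, `m³` (`carleman_pointwise`).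

The spatial flux vanishes since `φ` vanishes near `x = ±L`. Taking `m = s / ((t - α)(β - t))` makes
the weight vanish at the ends of the enlarged time interval fast enough to kill the energies there
(`weighted_observability`). On `[t₁, t₂]` the weight is bounded below, and it is bounded above
throughout. -/

variable {Ω : Opens (ℝ × ℝ)}

/-! ### Derivatives of test functions and the transposed operator. -/

/-- The time derivative of a test function. -/
noncomputable def dt (φ : 𝓓(Ω, ℝ)) : 𝓓(Ω, ℝ) := ∂_{((1, 0) : ℝ × ℝ)} φ

/-- The space derivative of a test function. -/
noncomputable def dx (φ : 𝓓(Ω, ℝ)) : 𝓓(Ω, ℝ) := ∂_{((0, 1) : ℝ × ℝ)} φ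

theorem lineDerivOp_apply_eq_fderiv (φ : 𝓓(Ω, ℝ)) (v z : ℝ × ℝ) :
    (∂_{v} φ) z = fderiv ℝ φ z v := by
  rw [TestFunction.lineDerivOp_eq_lineDerivCLM (𝕜 := ℝ), TestFunction.lineDerivCLM_eq_fderivCLM,
    TestFunction.fderivCLM_apply_of_le _ (by simp)]

theorem differentiable_testFunction (φ : 𝓓(Ω, ℝ)) : Differentiable ℝ φ :=
  φ.contDiff.differentiable (by simp)

theorem hasDerivAt_dt (φ : 𝓓(Ω, ℝ)) (t x : ℝ) :
    HasDerivAt (fun τ => φ (τ, x)) (dt φ (t, x)) t := by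
  rw [dt, lineDerivOp_apply_eq_fderiv]
  exact (differentiable_testFunction φ (t, x)).hasFDerivAt.comp_hasDerivAt t
    ((hasDerivAt_id t).prodMk (hasDerivAt_const t x))

theorem hasDerivAt_dx (φ : 𝓓(Ω, ℝ)) (t x : ℝ) :
    HasDerivAt (fun ξ => φ (t, ξ)) (dx φ (t, x)) x := by
  rw [dx, lineDerivOp_apply_eq_fderiv]
  exact (differentiable_testFunction φ (t, x)).hasFDerivAt.comp_hasDerivAt x
    ((hasDerivAt_const x t).prodMk (hasDerivAt_id x))

theorem dt_dx_comm (φ : 𝓓(Ω, ℝ)) : dt (dx φ) = dx (dt φ) := by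
  ext z
  have key : ∀ v w : ℝ × ℝ, (∂_{v} (∂_{w} φ)) z = fderiv ℝ (fderiv ℝ φ) z v w := by
    intro v w
    rw [lineDerivOp_apply_eq_fderiv]
    have h : ((∂_{w} φ : 𝓓(Ω, ℝ)) : ℝ × ℝ → ℝ) = fun z => fderiv ℝ φ z w := by
      ext z; rw [lineDerivOp_apply_eq_fderiv]
    have hd : DifferentiableAt ℝ (fderiv ℝ φ) z :=
      ((φ.contDiff.fderiv_right (m := 1) (by norm_cast)).differentiable (by simp)) z
    rw [h, fderiv_clm_apply hd (differentiableAt_const w)]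
    simp
  rw [dt, dx, dx, dt, key, key]
  exact (φ.contDiff.contDiffAt.isSymmSndFDerivAt (by simp; norm_cast)) _ _

theorem testFunction_eq_zero_of_notMem (φ : 𝓓(Ω, ℝ)) {z : ℝ × ℝ} (hz : z ∉ Ω) : φ z = 0 :=
  image_eq_zero_of_notMem_tsupport fun h => hz (φ.tsupport_subset h)

/-- The formal transpose of `P`, up to sign, on test functions. -/
noncomputable def adj (φ : 𝓓(Ω, ℝ)) : 𝓓(Ω, ℝ) := dt φ + dx (dx φ) + dx (dx (dx φ))

/-- `adj` as a linear map. -/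
noncomputable def adjₗ : 𝓓(Ω, ℝ) →ₗ[ℝ] 𝓓(Ω, ℝ) where
  toFun := adj
  map_add' φ ψ := by
    simp only [adj, dt, dx, LineDeriv.lineDerivOp_add]
    abel
  map_smul' c φ := by
    simp only [adj, dt, dx, LineDeriv.lineDerivOp_smul, smul_add, RingHom.id_apply]

theorem P_apply (T : 𝓓'(Ω, ℝ)) (φ : 𝓓(Ω, ℝ)) : P T φ = - T (adj φ) := by
  simp only [P, adj, dt, dx]
  change (∂_{((1, 0) : ℝ × ℝ)} T) φ - (∂_{((0, 1) : ℝ × ℝ)} (∂_{((0, 1) : ℝ × ℝ)} T)) φ +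
    (∂_{((0, 1) : ℝ × ℝ)} (∂_{((0, 1) : ℝ × ℝ)} (∂_{((0, 1) : ℝ × ℝ)} T))) φ = _
  simp only [Distribution.lineDerivOp_apply_apply, map_neg, map_add]
  ring

/-! ### Abstract duality and supports. -/

/-- The bound makes `l` factor through the range of `T`, with norm at most `M`; Hahn–Banach extends
it to `H` and Riesz represents the extension. -/
theorem exists_inner_eq_of_abs_le {E H : Type*} [AddCommGroup E] [Module ℝ E]
    [NormedAddCommGroup H] [InnerProductSpace ℝ H] [CompleteSpace H]
    (T : E →ₗ[ℝ] H) (l : E →ₗ[ℝ] ℝ) (M : ℝ) (hM : 0 ≤ M) (h : ∀ e, |l e| ≤ M * ‖T e‖) :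
    ∃ w : H, ‖w‖ ≤ M ∧ ∀ e, inner ℝ w (T e) = l e := by
  have hker : LinearMap.ker T ≤ LinearMap.ker l := by
    intro e he
    have := h e
    rw [LinearMap.mem_ker] at he ⊢
    rw [he] at this
    simpa using this
  let l' : LinearMap.range T →ₗ[ℝ] ℝ :=
    ((LinearMap.ker T).liftQ l hker).comp T.quotKerEquivRange.symm.toLinearMap
  have hl' : ∀ e, l' ⟨T e, LinearMap.mem_range_self T e⟩ = l e := by
    intro e
    have : T.quotKerEquivRange.symm ⟨T e, LinearMap.mem_range_self T e⟩
        = (LinearMap.ker T).mkQ e := T.quotKerEquivRange_symm_apply_image e _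
    simp only [l', LinearMap.comp_apply, LinearEquiv.coe_coe, this]
    simp
  let L : LinearMap.range T →L[ℝ] ℝ := l'.mkContinuous M (by
    rintro ⟨_, e, rfl⟩
    rw [hl' e]
    exact h e)
  obtain ⟨g, hg, hgn⟩ := exists_extension_norm_eq (LinearMap.range T) L
  refine ⟨(InnerProductSpace.toDual ℝ H).symm g, ?_, fun e => ?_⟩
  · rw [LinearIsometryEquiv.norm_map, hgn]
    exact LinearMap.mkContinuous_norm_le _ hM _
  · rw [InnerProductSpace.toDual_symm_apply]
    exact (hg ⟨T e, LinearMap.mem_range_self T e⟩).trans (hl' e)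

/-- Off the support `u` vanishes a.e. only near each point; second countability of the plane makes
the uncountable union of these null sets null. -/
theorem ae_eq_zero_of_supportIn_subset {u : ℝ × ℝ → ℝ} {s : Set (ℝ × ℝ)}
    (h : supportIn Ω u ⊆ s) :
    ∀ᵐ w ∂(volume : Measure (ℝ × ℝ)).restrict (Ω : Set (ℝ × ℝ)), w ∉ s → u w = 0 := by
  rw [ae_restrict_iff' Ω.isOpen.measurableSet, ae_iff]
  refine measure_null_of_locally_null _ fun z hz => ?_
  simp only [Set.mem_ofPred_eq, Classical.not_imp] at hz
  have hz' : z ∉ supportIn Ω u := fun hz' => hz.2.1 (h hz')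
  simp only [supportIn, Set.mem_ofPred_eq, not_and, not_forall, not_not] at hz'
  obtain ⟨U, hU, hUz⟩ := hz' hz.1
  rw [ae_restrict_iff' Ω.isOpen.measurableSet, ae_iff] at hUz
  refine ⟨_, Filter.inter_mem (mem_nhdsWithin_of_mem_nhds hU) self_mem_nhdsWithin,
    measure_mono_null ?_ hUz⟩
  rintro w ⟨hwU, hw⟩
  simp only [Set.mem_ofPred_eq, Classical.not_imp] at hw ⊢
  exact ⟨hw.1, hwU, hw.2.2⟩

theorem supportIn_subset_of_ae_eq_zero {u : ℝ × ℝ → ℝ} {s : Set (ℝ × ℝ)} (hs : IsClosed s)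
    (h : ∀ᵐ w ∂(volume : Measure (ℝ × ℝ)).restrict (Ω : Set (ℝ × ℝ)), w ∉ s → u w = 0) :
    supportIn Ω u ⊆ s := by
  rintro z ⟨-, hz⟩
  by_contra hzs
  exact hz sᶜ (hs.isOpen_compl.mem_nhds hzs) h

/-! ### The pointwise Carleman inequality. -/

/-- The density, in the squared first derivative and the squared function, of the energy that
appears in the Carleman identity. -/
noncomputable def energyDensity (L m m' y q q₁ : ℝ) : ℝ :=
  -3 * (m * y) * q₁ ^ 2 + ((m * y) ^ 3 + m' * (5 * L ^ 2 - y ^ 2 / 2) - m * y / 3) * q ^ 2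

/-- The time derivative of `energyDensity`. -/
noncomputable def energyRate (L m m' m'' y q q₁ qt q₁t : ℝ) : ℝ :=
  -3 * (m' * y) * q₁ ^ 2 - 6 * (m * y) * q₁ * q₁t
    + (3 * (m * y) ^ 2 * (m' * y) + m'' * (5 * L ^ 2 - y ^ 2 / 2) - m' * y / 3) * q ^ 2
    + 2 * ((m * y) ^ 3 + m' * (5 * L ^ 2 - y ^ 2 / 2) - m * y / 3) * q * qt

/-- The spatial flux in the Carleman identity. -/
noncomputable def flux (L m m' y q q₁ q₂ qt : ℝ) : ℝ :=
  6 * (m * y) * q₁ * qt + 3 * (m * y) * q₂ ^ 2 + 9 * (m * y) ^ 3 * q₁ ^ 2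
    - 18 * m * (m * y) ^ 2 * q * q₁ - 9 * m ^ 2 * (m * y) * q ^ 2 - m * y * q₁ ^ 2
    - 6 * m * q₁ * q₂
    + ((m * y) ^ 3 + m' * (5 * L ^ 2 - y ^ 2 / 2) - m * y / 3) *
      (2 * q * q₂ - q₁ ^ 2 + 3 * (m * y) ^ 2 * q ^ 2 - q ^ 2 / 3)
    - 2 * (-3 * m * (m * y) ^ 2 + m' * y + m / 3) * q * q₁
    + (6 * m ^ 2 * (m * y) - m') * q ^ 2

/-- The spatial derivative of `flux`. -/
noncomputable def fluxRate (L m m' y q q₁ q₂ q₃ qt q₁t : ℝ) : ℝ :=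
  2 * (3 * (m * y) * q₂ - 3 * m * q₁
      + ((m * y) ^ 3 + m' * (5 * L ^ 2 - y ^ 2 / 2) - m * y / 3) * q)
    * (q₃ + 3 * (m * y) ^ 2 * q₁ - 3 * m * (m * y) * q - q₁ / 3)
  + 6 * (m * y) * q₂ * qt + 6 * (m * y) * q₁ * q₁t - 6 * m * q₁ * qt
  - 9 * m * q₂ ^ 2 - (18 * m * (m * y) ^ 2 + 2 * m + 3 * (m' * y)) * q₁ ^ 2
  - (9 * m * (m * y) ^ 4 - 3 * m ^ 3 - 3 * (m * y) ^ 2 * (m' * y) - 2 * m * (m * y) ^ 2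
    + m' * y / 3 + m / 9) * q ^ 2

theorem hasDerivAt_flux {L m m' : ℝ} {q q₁ q₂ q₃ qt q₁t : ℝ → ℝ} {x : ℝ}
    (hq : HasDerivAt q (q₁ x) x) (hq₁ : HasDerivAt q₁ (q₂ x) x) (hq₂ : HasDerivAt q₂ (q₃ x) x)
    (hqt : HasDerivAt qt (q₁t x) x) :
    HasDerivAt (fun ξ => flux L m m' (2 * L - ξ) (q ξ) (q₁ ξ) (q₂ ξ) (qt ξ))
      (fluxRate L m m' (2 * L - x) (q x) (q₁ x) (q₂ x) (q₃ x) (qt x) (q₁t x)) x := by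
  have hy : HasDerivAt (fun ξ : ℝ => 2 * L - ξ) (-1) x := by
    simpa using (hasDerivAt_id x).const_sub (2 * L)
  have ha : HasDerivAt (fun ξ : ℝ => m * (2 * L - ξ)) (-m) x := by
    simpa using hy.const_mul m
  have hc : HasDerivAt (fun ξ : ℝ => (m * (2 * L - ξ)) ^ 3
      + m' * (5 * L ^ 2 - (2 * L - ξ) ^ 2 / 2) - m * (2 * L - ξ) / 3)
      (-3 * m * (m * (2 * L - x)) ^ 2 + m' * (2 * L - x) + m / 3) x := by
    refine (((ha.fun_pow 3).fun_add ((((hy.fun_pow 2).div_const 2).const_sub (5 * L ^ 2)).const_mul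
      m')).fun_sub (ha.div_const 3)).congr_deriv ?_
    norm_num; ring
  unfold flux fluxRate
  refine ((((((((((ha.const_mul 6).fun_mul hq₁).fun_mul hqt).fun_add
    ((ha.const_mul 3).fun_mul (hq₂.fun_pow 2))).fun_add
    (((ha.fun_pow 3).const_mul 9).fun_mul (hq₁.fun_pow 2))).fun_sub
    ((((ha.fun_pow 2).const_mul (18 * m)).fun_mul hq).fun_mul hq₁)).fun_sub
    ((ha.const_mul (9 * m ^ 2)).fun_mul (hq.fun_pow 2))).fun_sub
    (ha.fun_mul (hq₁.fun_pow 2))).fun_sub ((hq₁.const_mul (6 * m)).fun_mul hq₂)).fun_add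
    (hc.fun_mul (((((hq.const_mul 2).fun_mul hq₂).fun_sub (hq₁.fun_pow 2)).fun_add
      (((ha.fun_pow 2).const_mul 3).fun_mul (hq.fun_pow 2))).fun_sub
      ((hq.fun_pow 2).div_const 3)))).fun_sub
    (((((((ha.fun_pow 2).const_mul (-3 * m)).fun_add (hy.const_mul m')).fun_add
      (hasDerivAt_const x (m / 3))).const_mul 2).fun_mul hq).fun_mul hq₁) |>.fun_add
    (((ha.const_mul (6 * m ^ 2)).fun_sub (hasDerivAt_const x m')).fun_mul (hq.fun_pow 2))
    |>.congr_deriv ?_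
  norm_num
  ring

theorem hasDerivAt_energyDensity {L y : ℝ} {m m' m'' q q₁ qt q₁t : ℝ → ℝ} {t : ℝ}
    (hm : HasDerivAt m (m' t) t) (hm' : HasDerivAt m' (m'' t) t)
    (hq : HasDerivAt q (qt t) t) (hq₁ : HasDerivAt q₁ (q₁t t) t) :
    HasDerivAt (fun τ => energyDensity L (m τ) (m' τ) y (q τ) (q₁ τ))
      (energyRate L (m t) (m' t) (m'' t) y (q t) (q₁ t) (qt t) (q₁t t)) t := by
  unfold energyDensity energyRate
  refine ((((hm.mul_const y).const_mul (-3)).fun_mul (hq₁.fun_pow 2)).fun_add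
    (((((hm.mul_const y).fun_pow 3).fun_add (hm'.mul_const (5 * L ^ 2 - y ^ 2 / 2))).fun_sub
      ((hm.mul_const y).div_const 3)).fun_mul (hq.fun_pow 2))).congr_deriv ?_
  norm_num
  ring

/-- The zeroth order coefficient of the quadratic form in the Carleman identity dominates. -/
theorem one_le_zeroth_coeff {L m m' m'' y : ℝ} (hL : 0 < L) (hy : L ≤ y) (hy' : y ≤ 3 * L)
    (hm : 1 ≤ m) (hmL : 4 ≤ m * L) (hmL2 : 1 ≤ m * L ^ 2) (hm' : |m'| ≤ m ^ 2)
    (hm'' : |m''| ≤ m ^ 3) :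
    1 ≤ 9 * m * (m * y) ^ 4 - 3 * m ^ 3 - 6 * (m * y) ^ 2 * (m' * y) - 2 * m * (m * y) ^ 2
      + 2 / 3 * (m' * y) + m / 9 - m'' * (5 * L ^ 2 - y ^ 2 / 2) := by
  have hy0 : 0 < y := hL.trans_le hy
  have hm0 : 0 < m := by linarith
  set u := m * y with hu
  have hu4 : 4 ≤ u := hmL.trans (mul_le_mul_of_nonneg_left hy hm0.le)
  -- The term `9 m u⁴` must absorb all the others. This bound spends `3 m u⁴` of it on `3 m³`.
  have h1 : m ^ 3 ≤ m * u ^ 4 := by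
    have : 1 ≤ m * y ^ 2 := hmL2.trans (by gcongr)
    have h2 : 1 ≤ (m * y ^ 2) ^ 2 := one_le_pow₀ this
    calc m ^ 3 = m ^ 3 * 1 := by ring
      _ ≤ m ^ 3 * (m * y ^ 2) ^ 2 := by gcongr
      _ = m * u ^ 4 := by rw [hu]; ring
  have h2 : |m' * y| ≤ m * u := by
    rw [abs_mul, abs_of_pos hy0, hu]
    calc |m'| * y ≤ m ^ 2 * y := by gcongr
      _ = _ := by ring
  have h3 : 6 * u ^ 2 * (m' * y) ≤ 6 * u ^ 2 * (m * u) := by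
    have := (abs_le.1 h2).2
    gcongr
  have h4 : -(m * u) ≤ m' * y := (abs_le.1 h2).1
  have h5 : m'' * (5 * L ^ 2 - y ^ 2 / 2) ≤ 4.5 * m * u ^ 2 := by
    have hψ : 0 ≤ 5 * L ^ 2 - y ^ 2 / 2 := by nlinarith
    -- From `L ≤ y`: `5 - 1/2 = 4.5`.
    have hψ' : 5 * L ^ 2 - y ^ 2 / 2 ≤ 4.5 * y ^ 2 := by nlinarith
    calc m'' * (5 * L ^ 2 - y ^ 2 / 2) ≤ m ^ 3 * (4.5 * y ^ 2) :=
          mul_le_mul ((le_abs_self _).trans hm'') hψ' hψ (by positivity)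
      _ = _ := by rw [hu]; ring
  have h6 : 1 ≤ 6 * u ^ 4 - 6 * u ^ 3 - 6.5 * u ^ 2 - u := by
    clear_value u
    -- Expanded at `u = 4`, the polynomial has only nonnegative coefficients in `w`.
    obtain ⟨w, rfl⟩ : ∃ w, u = 4 + w := ⟨u - 4, by ring⟩
    have hw : 0 ≤ w := by linarith
    have : 0 ≤ w ^ 4 := by positivity
    have : 0 ≤ w ^ 3 := by positivity
    have : 0 ≤ w ^ 2 := by positivity
    ring_nf
    linarith
  have h7 : m * 1 ≤ m * (6 * u ^ 4 - 6 * u ^ 3 - 6.5 * u ^ 2 - u) :=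
    mul_le_mul_of_nonneg_left h6 hm0.le
  have h8 : 0 ≤ m * u := by positivity
  linarith

/-- With `a = m y` (so `a_x = -m`), the right side is `(S + K)²`, where `S = 3 a q₂ - 3 m q₁ + (a³ +
m' ψ - a/3) q` is symmetric and `K = qt + q₃ + 3 a² q₁ - 3 m a q - q₁/3` is skew. The identity is `2
S K = energyRate + fluxRate + 9 m q₂² + (…) q₁² + (…) q²`, with both omitted coefficients
nonnegative and the last one at least `1`. -/
theorem carleman_pointwise {L m m' m'' y q q₁ q₂ q₃ qt q₁t : ℝ} (hL : 0 < L) (hy : L ≤ y)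
    (hy' : y ≤ 3 * L) (hm : 1 ≤ m) (hmL : 4 ≤ m * L) (hmL2 : 1 ≤ m * L ^ 2)
    (hm' : |m'| ≤ m ^ 2) (hm'' : |m''| ≤ m ^ 3) :
    q ^ 2 + energyRate L m m' m'' y q q₁ qt q₁t + fluxRate L m m' y q q₁ q₂ q₃ qt q₁t ≤
      (qt + q₃ + 3 * (m * y) * q₂ + 3 * ((m * y) ^ 2 - m) * q₁
        + ((m * y) ^ 3 - 3 * m * (m * y) + m' * (5 * L ^ 2 - y ^ 2 / 2)) * q
        - (q₁ + m * y * q) / 3) ^ 2 := by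
  have hm0 : 0 < m := by linarith
  have hy0 : 0 < y := hL.trans_le hy
  have hQ0 := mul_le_mul_of_nonneg_right
    (one_le_zeroth_coeff hL hy hy' hm hmL hmL2 hm' hm'') (sq_nonneg q)
  have hQ1 : 0 ≤ 18 * m * (m * y) ^ 2 + 2 * m + 6 * (m' * y) := by
    have h1 : -(m ^ 2 * y) ≤ m' * y := by
      have := mul_le_mul_of_nonneg_right (abs_le.1 hm').1 hy0.le
      linarith
    nlinarith [mul_nonneg hm0.le (sq_nonneg (3 * (m * y) - 1)), mul_nonneg hm0.le
      (mul_nonneg hm0.le hy0.le), mul_nonneg hm0.le (sq_nonneg (m * y))]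
  have hQ1' := mul_nonneg hQ1 (sq_nonneg q₁)
  have hQ2 : 0 ≤ 9 * m * q₂ ^ 2 := by positivity
  have hS := sq_nonneg (3 * (m * y) * q₂ - 3 * m * q₁
      + ((m * y) ^ 3 + m' * (5 * L ^ 2 - y ^ 2 / 2) - m * y / 3) * q)
  have hK := sq_nonneg (qt + q₃ + 3 * (m * y) ^ 2 * q₁ - 3 * m * (m * y) * q - q₁ / 3)
  unfold energyRate fluxRate
  linear_combination hQ0 + hQ1' + hQ2 + hS + hK

/-! ### Integrating a partial derivative over a rectangle. -/

theorem setIntegral_prod_of_hasDerivAt_snd {a b c d : ℝ} (hab : a ≤ b) {G g : ℝ × ℝ → ℝ}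
    (hg : ContinuousOn g (Set.Icc c d ×ˢ Set.Icc a b))
    (h : ∀ t ∈ Set.Icc c d, ∀ x ∈ Set.Icc a b, HasDerivAt (fun ξ => G (t, ξ)) (g (t, x)) x) :
    ∫ z in Set.Icc c d ×ˢ Set.Icc a b, g z = ∫ t in Set.Icc c d, (G (t, b) - G (t, a)) := by
  rw [Measure.volume_eq_prod, setIntegral_prod _
    (hg.integrableOn_compact (isCompact_Icc.prod isCompact_Icc))]
  refine setIntegral_congr_fun measurableSet_Icc fun t ht => ?_
  have hgt : ContinuousOn (fun x => g (t, x)) (Set.Icc a b) :=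
    hg.comp (by fun_prop) fun x hx => ⟨ht, hx⟩
  rw [integral_Icc_eq_integral_Ioc, ← intervalIntegral.integral_of_le hab]
  refine intervalIntegral.integral_eq_sub_of_hasDerivAt (f := fun x => G (t, x)) ?_ ?_
  · rw [Set.uIcc_of_le hab]
    exact h t ht
  · exact ContinuousOn.intervalIntegrable (by rwa [Set.uIcc_of_le hab])

theorem setIntegral_prod_of_hasDerivAt_fst {a b c d : ℝ} (hcd : c ≤ d) {G g : ℝ × ℝ → ℝ}
    (hg : ContinuousOn g (Set.Icc c d ×ˢ Set.Icc a b))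
    (h : ∀ t ∈ Set.Icc c d, ∀ x ∈ Set.Icc a b, HasDerivAt (fun τ => G (τ, x)) (g (t, x)) t) :
    ∫ z in Set.Icc c d ×ˢ Set.Icc a b, g z = ∫ x in Set.Icc a b, (G (d, x) - G (c, x)) := by
  have hswap : ContinuousOn (fun z : ℝ × ℝ => g z.swap) (Set.Icc a b ×ˢ Set.Icc c d) :=
    hg.comp (by fun_prop) fun z hz => ⟨hz.2, hz.1⟩
  refine Eq.trans ?_ (setIntegral_prod_of_hasDerivAt_snd (G := fun z => G z.swap) hcd hswap
    fun x hx t ht => h t ht x hx)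
  rw [Measure.volume_eq_prod]
  exact (setIntegral_prod_swap (μ := (volume : Measure ℝ)) (ν := (volume : Measure ℝ))
    (Set.Icc c d) (Set.Icc a b) g).symm

/-! ### The weighted test function and its derivatives. -/

/-- The Carleman weight attached to the function `m` of time. -/
noncomputable def weight (L : ℝ) (m : ℝ → ℝ) (z : ℝ × ℝ) : ℝ :=
  Real.exp (-(m z.1 * (5 * L ^ 2 - (2 * L - z.2) ^ 2 / 2) - z.2 / 3 - 2 * z.1 / 27))

/-- The function `weight * φ`. -/
noncomputable def conj₀ (L : ℝ) (m : ℝ → ℝ) (φ : 𝓓(Ω, ℝ)) (z : ℝ × ℝ) : ℝ :=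
  weight L m z * φ z

/-- The space derivative of `weight * φ`. -/
noncomputable def conj₁ (L : ℝ) (m : ℝ → ℝ) (φ : 𝓓(Ω, ℝ)) (z : ℝ × ℝ) : ℝ :=
  weight L m z * (dx φ z - (m z.1 * (2 * L - z.2) - 1 / 3) * φ z)

/-- The second space derivative of `weight * φ`. -/
noncomputable def conj₂ (L : ℝ) (m : ℝ → ℝ) (φ : 𝓓(Ω, ℝ)) (z : ℝ × ℝ) : ℝ :=
  weight L m z * (dx (dx φ) z - 2 * (m z.1 * (2 * L - z.2) - 1 / 3) * dx φ z
    + ((m z.1 * (2 * L - z.2) - 1 / 3) ^ 2 + m z.1) * φ z)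

/-- The third space derivative of `weight * φ`. -/
noncomputable def conj₃ (L : ℝ) (m : ℝ → ℝ) (φ : 𝓓(Ω, ℝ)) (z : ℝ × ℝ) : ℝ :=
  weight L m z * (dx (dx (dx φ)) z - 3 * (m z.1 * (2 * L - z.2) - 1 / 3) * dx (dx φ) z
    + (3 * (m z.1 * (2 * L - z.2) - 1 / 3) ^ 2 + 3 * m z.1) * dx φ z
    - ((m z.1 * (2 * L - z.2) - 1 / 3) ^ 3
      + 3 * (m z.1 * (2 * L - z.2) - 1 / 3) * m z.1) * φ z)

/-- The time derivative of `weight * φ`. -/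
noncomputable def conjt (L : ℝ) (m m' : ℝ → ℝ) (φ : 𝓓(Ω, ℝ)) (z : ℝ × ℝ) : ℝ :=
  weight L m z * (dt φ z - (m' z.1 * (5 * L ^ 2 - (2 * L - z.2) ^ 2 / 2) - 2 / 27) * φ z)

/-- The mixed second derivative of `weight * φ`. -/
noncomputable def conj₁t (L : ℝ) (m m' : ℝ → ℝ) (φ : 𝓓(Ω, ℝ)) (z : ℝ × ℝ) : ℝ :=
  weight L m z * (dx (dt φ) z
    - (m' z.1 * (5 * L ^ 2 - (2 * L - z.2) ^ 2 / 2) - 2 / 27) * dx φ z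
    - (m z.1 * (2 * L - z.2) - 1 / 3) *
      (dt φ z - (m' z.1 * (5 * L ^ 2 - (2 * L - z.2) ^ 2 / 2) - 2 / 27) * φ z)
    - m' z.1 * (2 * L - z.2) * φ z)

section derivatives

variable (L : ℝ) (m m' : ℝ → ℝ) (φ : 𝓓(Ω, ℝ)) (t x : ℝ)

theorem hasDerivAt_coeff : HasDerivAt (fun ξ : ℝ => m t * (2 * L - ξ) - 1 / 3) (-m t) x := by
  simpa using ((((hasDerivAt_id x).const_sub (2 * L)).const_mul (m t)).sub_const (1 / 3))

theorem hasDerivAt_parabola :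
    HasDerivAt (fun ξ : ℝ => 5 * L ^ 2 - (2 * L - ξ) ^ 2 / 2) (2 * L - x) x := by
  refine (((((hasDerivAt_id' x).const_sub (2 * L)).fun_pow 2).div_const 2).const_sub
    (5 * L ^ 2)).congr_deriv ?_
  norm_num; ring

theorem hasDerivAt_weight_snd :
    HasDerivAt (fun ξ => weight L m (t, ξ))
      (-(weight L m (t, x) * (m t * (2 * L - x) - 1 / 3))) x := by
  unfold weight
  refine ((((((hasDerivAt_parabola L x).const_mul (m t)).fun_sub
    ((hasDerivAt_id' x).div_const 3)).sub_const (2 * t / 27)).fun_neg).exp).congr_deriv ?_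
  ring

theorem hasDerivAt_conj₀_snd :
    HasDerivAt (fun ξ => conj₀ L m φ (t, ξ)) (conj₁ L m φ (t, x)) x := by
  unfold conj₀ conj₁
  refine ((hasDerivAt_weight_snd L m t x).fun_mul (hasDerivAt_dx φ t x)).congr_deriv ?_
  ring

theorem hasDerivAt_conj₁_snd :
    HasDerivAt (fun ξ => conj₁ L m φ (t, ξ)) (conj₂ L m φ (t, x)) x := by
  unfold conj₁ conj₂
  refine ((hasDerivAt_weight_snd L m t x).fun_mul ((hasDerivAt_dx (dx φ) t x).fun_sub
    ((hasDerivAt_coeff L m t x).fun_mul (hasDerivAt_dx φ t x)))).congr_deriv ?_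
  ring

theorem hasDerivAt_conj₂_snd :
    HasDerivAt (fun ξ => conj₂ L m φ (t, ξ)) (conj₃ L m φ (t, x)) x := by
  unfold conj₂ conj₃
  have hb := hasDerivAt_coeff L m t x
  refine ((hasDerivAt_weight_snd L m t x).fun_mul (((hasDerivAt_dx (dx (dx φ)) t x).fun_sub
    ((hb.const_mul 2).fun_mul (hasDerivAt_dx (dx φ) t x))).fun_add
    (((hb.fun_pow 2).add_const (m t)).fun_mul (hasDerivAt_dx φ t x)))).congr_deriv ?_
  norm_num; ring

theorem hasDerivAt_conjt_snd :
    HasDerivAt (fun ξ => conjt L m m' φ (t, ξ)) (conj₁t L m m' φ (t, x)) x := by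
  unfold conjt conj₁t
  refine ((hasDerivAt_weight_snd L m t x).fun_mul ((hasDerivAt_dx (dt φ) t x).fun_sub
    ((((hasDerivAt_parabola L x).const_mul (m' t)).sub_const (2 / 27)).fun_mul
      (hasDerivAt_dx φ t x)))).congr_deriv ?_
  ring

variable {m m' t}

theorem hasDerivAt_weight_fst (hm : HasDerivAt m (m' t) t) :
    HasDerivAt (fun τ => weight L m (τ, x))
      (-(weight L m (t, x) * (m' t * (5 * L ^ 2 - (2 * L - x) ^ 2 / 2) - 2 / 27))) t := by
  unfold weight
  refine (((((hm.mul_const (5 * L ^ 2 - (2 * L - x) ^ 2 / 2)).sub_const (x / 3)).fun_sub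
    (((hasDerivAt_id' t).const_mul 2).div_const 27)).fun_neg).exp).congr_deriv ?_
  ring

theorem hasDerivAt_conj₀_fst (hm : HasDerivAt m (m' t) t) :
    HasDerivAt (fun τ => conj₀ L m φ (τ, x)) (conjt L m m' φ (t, x)) t := by
  unfold conj₀ conjt
  refine ((hasDerivAt_weight_fst L x hm).fun_mul (hasDerivAt_dt φ t x)).congr_deriv ?_
  ring

theorem hasDerivAt_conj₁_fst (hm : HasDerivAt m (m' t) t) :
    HasDerivAt (fun τ => conj₁ L m φ (τ, x)) (conj₁t L m m' φ (t, x)) t := by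
  unfold conj₁ conj₁t
  rw [← dt_dx_comm]
  refine ((hasDerivAt_weight_fst L x hm).fun_mul ((hasDerivAt_dt (dx φ) t x).fun_sub
    (((hm.mul_const (2 * L - x)).sub_const (1 / 3)).fun_mul
      (hasDerivAt_dt φ t x)))).congr_deriv ?_
  ring

end derivatives

/-- With `D = ∂_x + 1/3` one has `∂_x³ + ∂_x² = D³ - D/3 + 2/27`. The factor `exp(x/3)` converts `D`
to `∂_x` and `exp(2t/27)` absorbs the constant. Conjugation by `exp(-mψ)` then replaces `∂_x` by
`∂_x + m y` and `∂_t` by `∂_t + m' ψ`. -/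
theorem conj_operator_eq (L : ℝ) (m m' : ℝ → ℝ) (φ : 𝓓(Ω, ℝ)) (z : ℝ × ℝ) :
    conjt L m m' φ z + conj₃ L m φ z + 3 * (m z.1 * (2 * L - z.2)) * conj₂ L m φ z
        + 3 * ((m z.1 * (2 * L - z.2)) ^ 2 - m z.1) * conj₁ L m φ z
        + ((m z.1 * (2 * L - z.2)) ^ 3 - 3 * m z.1 * (m z.1 * (2 * L - z.2))
          + m' z.1 * (5 * L ^ 2 - (2 * L - z.2) ^ 2 / 2)) * conj₀ L m φ z
        - (conj₁ L m φ z + m z.1 * (2 * L - z.2) * conj₀ L m φ z) / 3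
      = weight L m z * adj φ z := by
  have : adj φ z = dt φ z + dx (dx φ) z + dx (dx (dx φ)) z := rfl
  rw [this]
  unfold conj₀ conj₁ conj₂ conj₃ conjt
  ring

/-! ### Continuity of the integrands. -/

section continuity

variable {L : ℝ} {m m' m'' : ℝ → ℝ} (φ : 𝓓(Ω, ℝ)) {K : Set (ℝ × ℝ)}

theorem continuousOn_conj_spatial (cm : ContinuousOn (fun z : ℝ × ℝ => m z.1) K) :
    ContinuousOn (weight L m) K ∧ ContinuousOn (conj₀ L m φ) K ∧ ContinuousOn (conj₁ L m φ) K ∧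
      ContinuousOn (conj₂ L m φ) K ∧ ContinuousOn (conj₃ L m φ) K := by
  -- Continuity of `m` is known only as that of `z ↦ m z.1` on `K`, so this map is kept as an opaque
  -- `M`.
  obtain ⟨M, hM⟩ : ∃ M : ℝ × ℝ → ℝ, ∀ z, M z = m z.1 := ⟨_, fun _ => rfl⟩
  simp only [← hM] at cm
  have cf : ∀ ψ : 𝓓(Ω, ℝ), ContinuousOn (fun z => ψ z) K :=
    fun ψ => ψ.continuous.continuousOn
  have f0 := cf φ
  have f1 := cf (dx φ)
  have f2 := cf (dx (dx φ))
  have f3 := cf (dx (dx (dx φ)))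
  have cw : ContinuousOn (weight L m) K := by
    unfold weight
    simp only [← hM]
    fun_prop
  refine ⟨cw, ?_, ?_, ?_, ?_⟩
  · unfold conj₀
    fun_prop
  · unfold conj₁
    simp only [← hM]
    fun_prop
  · unfold conj₂
    simp only [← hM]
    fun_prop
  · unfold conj₃
    simp only [← hM]
    fun_prop

theorem continuousOn_conj_temporal (cm : ContinuousOn (fun z : ℝ × ℝ => m z.1) K)
    (cm' : ContinuousOn (fun z : ℝ × ℝ => m' z.1) K) :
    ContinuousOn (conjt L m m' φ) K ∧ ContinuousOn (conj₁t L m m' φ) K := by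
  have cw := (continuousOn_conj_spatial (L := L) φ cm).1
  obtain ⟨M, hM⟩ : ∃ M : ℝ × ℝ → ℝ, ∀ z, M z = m z.1 := ⟨_, fun _ => rfl⟩
  obtain ⟨M', hM'⟩ : ∃ M' : ℝ × ℝ → ℝ, ∀ z, M' z = m' z.1 := ⟨_, fun _ => rfl⟩
  simp only [← hM] at cm
  simp only [← hM'] at cm'
  have cf : ∀ ψ : 𝓓(Ω, ℝ), ContinuousOn (fun z => ψ z) K :=
    fun ψ => ψ.continuous.continuousOn
  have f0 := cf φ
  have f1 := cf (dx φ)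
  have f2 := cf (dt φ)
  have f3 := cf (dx (dt φ))
  constructor
  · unfold conjt
    simp only [← hM']
    fun_prop
  · unfold conj₁t
    simp only [← hM, ← hM']
    fun_prop

theorem continuousOn_energyRate {M M' M'' q q₁ qt q₁t : ℝ × ℝ → ℝ} (cm : ContinuousOn M K)
    (cm' : ContinuousOn M' K) (cm'' : ContinuousOn M'' K) (c0 : ContinuousOn q K)
    (c1 : ContinuousOn q₁ K) (ct : ContinuousOn qt K) (c1t : ContinuousOn q₁t K) :
    ContinuousOn (fun z : ℝ × ℝ => energyRate L (M z) (M' z) (M'' z) (2 * L - z.2)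
      (q z) (q₁ z) (qt z) (q₁t z)) K := by
  unfold energyRate
  fun_prop

theorem continuousOn_fluxRate {M M' q q₁ q₂ q₃ qt q₁t : ℝ × ℝ → ℝ} (cm : ContinuousOn M K)
    (cm' : ContinuousOn M' K) (c0 : ContinuousOn q K) (c1 : ContinuousOn q₁ K)
    (c2 : ContinuousOn q₂ K) (c3 : ContinuousOn q₃ K) (ct : ContinuousOn qt K)
    (c1t : ContinuousOn q₁t K) :
    ContinuousOn (fun z : ℝ × ℝ => fluxRate L (M z) (M' z) (2 * L - z.2)
      (q z) (q₁ z) (q₂ z) (q₃ z) (qt z) (q₁t z)) K := by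
  unfold fluxRate
  fun_prop

end continuity

/-! ### The integrated Carleman inequality. -/

/-- The energy density of `weight * φ`. -/
noncomputable def energyAt (L : ℝ) (m m' : ℝ → ℝ) (φ : 𝓓(Ω, ℝ)) (z : ℝ × ℝ) : ℝ :=
  energyDensity L (m z.1) (m' z.1) (2 * L - z.2) (conj₀ L m φ z) (conj₁ L m φ z)

/-- The time derivative of `energyAt`. -/
noncomputable def energyRateAt (L : ℝ) (m m' m'' : ℝ → ℝ) (φ : 𝓓(Ω, ℝ)) (z : ℝ × ℝ) : ℝ :=
  energyRate L (m z.1) (m' z.1) (m'' z.1) (2 * L - z.2) (conj₀ L m φ z) (conj₁ L m φ z)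
    (conjt L m m' φ z) (conj₁t L m m' φ z)

/-- The spatial flux of `weight * φ`. -/
noncomputable def fluxAt (L : ℝ) (m m' : ℝ → ℝ) (φ : 𝓓(Ω, ℝ)) (z : ℝ × ℝ) : ℝ :=
  flux L (m z.1) (m' z.1) (2 * L - z.2) (conj₀ L m φ z) (conj₁ L m φ z) (conj₂ L m φ z)
    (conjt L m m' φ z)

/-- The space derivative of `fluxAt`. -/
noncomputable def fluxRateAt (L : ℝ) (m m' : ℝ → ℝ) (φ : 𝓓(Ω, ℝ)) (z : ℝ × ℝ) : ℝ :=
  fluxRate L (m z.1) (m' z.1) (2 * L - z.2) (conj₀ L m φ z) (conj₁ L m φ z) (conj₂ L m φ z)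
    (conj₃ L m φ z) (conjt L m m' φ z) (conj₁t L m m' φ z)

theorem hasDerivAt_energyAt (L : ℝ) {m m' m'' : ℝ → ℝ} (φ : 𝓓(Ω, ℝ)) {t : ℝ}
    (hm : HasDerivAt m (m' t) t) (hm' : HasDerivAt m' (m'' t) t) (x : ℝ) :
    HasDerivAt (fun τ => energyAt L m m' φ (τ, x)) (energyRateAt L m m' m'' φ (t, x)) t :=
  hasDerivAt_energyDensity (y := 2 * L - x)
    (q := fun τ => conj₀ L m φ (τ, x)) (q₁ := fun τ => conj₁ L m φ (τ, x))
    (qt := fun τ => conjt L m m' φ (τ, x)) (q₁t := fun τ => conj₁t L m m' φ (τ, x))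
    hm hm' (hasDerivAt_conj₀_fst L φ x hm) (hasDerivAt_conj₁_fst L φ x hm)

theorem hasDerivAt_fluxAt (L : ℝ) (m m' : ℝ → ℝ) (φ : 𝓓(Ω, ℝ)) (t x : ℝ) :
    HasDerivAt (fun ξ => fluxAt L m m' φ (t, ξ)) (fluxRateAt L m m' φ (t, x)) x :=
  hasDerivAt_flux (L := L) (m := m t) (m' := m' t)
    (q := fun ξ => conj₀ L m φ (t, ξ)) (q₁ := fun ξ => conj₁ L m φ (t, ξ))
    (q₂ := fun ξ => conj₂ L m φ (t, ξ)) (q₃ := fun ξ => conj₃ L m φ (t, ξ))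
    (qt := fun ξ => conjt L m m' φ (t, ξ)) (q₁t := fun ξ => conj₁t L m m' φ (t, ξ))
    (hasDerivAt_conj₀_snd L m φ t x) (hasDerivAt_conj₁_snd L m φ t x)
    (hasDerivAt_conj₂_snd L m φ t x) (hasDerivAt_conjt_snd L m m' φ t x)

theorem fluxAt_eq_zero_of_notMem (L : ℝ) (m m' : ℝ → ℝ) (φ : 𝓓(Ω, ℝ)) {z : ℝ × ℝ} (hz : z ∉ Ω) :
    fluxAt L m m' φ z = 0 := by
  simp [fluxAt, flux, conj₀, conj₁, conj₂, conjt, testFunction_eq_zero_of_notMem _ hz]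

/-- The integrated Carleman inequality with boundary terms in time. -/
theorem carleman_integral {L : ℝ} (hL : 0 < L) {c d : ℝ} (hcd : c ≤ d) {m m' m'' : ℝ → ℝ}
    (hm : ∀ t ∈ Set.Icc c d, HasDerivAt m (m' t) t)
    (hm' : ∀ t ∈ Set.Icc c d, HasDerivAt m' (m'' t) t)
    (hm'' : ContinuousOn m'' (Set.Icc c d))
    (h1 : ∀ t ∈ Set.Icc c d, 1 ≤ m t) (h2 : ∀ t ∈ Set.Icc c d, 4 ≤ m t * L)
    (h3 : ∀ t ∈ Set.Icc c d, 1 ≤ m t * L ^ 2) (h4 : ∀ t ∈ Set.Icc c d, |m' t| ≤ m t ^ 2)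
    (h5 : ∀ t ∈ Set.Icc c d, |m'' t| ≤ m t ^ 3) (φ : 𝓓(strip L, ℝ)) :
    (∫ z in Set.Icc c d ×ˢ Set.Icc (-L) L, (weight L m z * φ z) ^ 2)
      + (∫ x in Set.Icc (-L) L, (energyAt L m m' φ (d, x) - energyAt L m m' φ (c, x)))
      ≤ ∫ z in Set.Icc c d ×ˢ Set.Icc (-L) L, (weight L m z * adj φ z) ^ 2 := by
  have hLL : -L ≤ L := by linarith
  have hKc : IsCompact (Set.Icc c d ×ˢ Set.Icc (-L) L) := isCompact_Icc.prod isCompact_Icc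
  have cm : ContinuousOn (fun z : ℝ × ℝ => m z.1) (Set.Icc c d ×ˢ Set.Icc (-L) L) :=
    ContinuousOn.comp (fun t ht => (hm t ht).continuousAt.continuousWithinAt)
      continuous_fst.continuousOn fun z hz => hz.1
  have cm' : ContinuousOn (fun z : ℝ × ℝ => m' z.1) (Set.Icc c d ×ˢ Set.Icc (-L) L) :=
    ContinuousOn.comp (fun t ht => (hm' t ht).continuousAt.continuousWithinAt)
      continuous_fst.continuousOn fun z hz => hz.1
  have cm'' : ContinuousOn (fun z : ℝ × ℝ => m'' z.1) (Set.Icc c d ×ˢ Set.Icc (-L) L) :=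
    hm''.comp continuous_fst.continuousOn fun z hz => hz.1
  obtain ⟨cw, c0, c1, c2, c3⟩ := continuousOn_conj_spatial (L := L) φ cm
  obtain ⟨ct, c1t⟩ := continuousOn_conj_temporal (L := L) φ cm cm'
  have ce : ContinuousOn (energyRateAt L m m' m'' φ) (Set.Icc c d ×ˢ Set.Icc (-L) L) :=
    continuousOn_energyRate cm cm' cm'' c0 c1 ct c1t
  have cr : ContinuousOn (fluxRateAt L m m' φ) (Set.Icc c d ×ˢ Set.Icc (-L) L) :=
    continuousOn_fluxRate cm cm' c0 c1 c2 c3 ct c1t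
  have hE := setIntegral_prod_of_hasDerivAt_fst hcd ce fun t ht x _ =>
    hasDerivAt_energyAt L φ (hm t ht) (hm' t ht) x
  have hF := setIntegral_prod_of_hasDerivAt_snd hLL cr fun t _ x _ =>
    hasDerivAt_fluxAt L m m' φ t x
  -- The lateral sides lie outside the open strip, where `φ` and all its derivatives vanish.
  have hF0 : (∫ z in Set.Icc c d ×ˢ Set.Icc (-L) L, fluxRateAt L m m' φ z) = 0 := by
    have hz : ∀ t x, (x = L ∨ x = -L) → ((t, x) : ℝ × ℝ) ∉ strip L := by
      rintro t x hx ⟨-, h, h'⟩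
      rcases hx with rfl | rfl <;> simp at h h'
    rw [hF]
    simp [fluxAt_eq_zero_of_notMem L m m' φ (hz _ L (.inl rfl)),
      fluxAt_eq_zero_of_notMem L m m' φ (hz _ (-L) (.inr rfl))]
  have i0 : IntegrableOn (fun z => (weight L m z * φ z) ^ 2) (Set.Icc c d ×ˢ Set.Icc (-L) L) :=
    (c0.pow 2).integrableOn_compact hKc
  have ie := ce.integrableOn_compact hKc (μ := volume)
  have ir := cr.integrableOn_compact hKc (μ := volume)
  have ig : IntegrableOn (fun z => (weight L m z * adj φ z) ^ 2)
      (Set.Icc c d ×ˢ Set.Icc (-L) L) :=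
    ((cw.mul (adj φ).continuous.continuousOn).pow 2).integrableOn_compact hKc
  have hpt : ∀ z ∈ Set.Icc c d ×ˢ Set.Icc (-L) L, (weight L m z * φ z) ^ 2
      + energyRateAt L m m' m'' φ z + fluxRateAt L m m' φ z ≤ (weight L m z * adj φ z) ^ 2 := by
    rintro z ⟨ht, hx⟩
    rw [← conj_operator_eq L m m' φ z]
    exact carleman_pointwise (q := conj₀ L m φ z) hL (by linarith [hx.2]) (by linarith [hx.1])
      (h1 _ ht) (h2 _ ht) (h3 _ ht) (h4 _ ht) (h5 _ ht)
  have hmono := setIntegral_mono_on ((i0.add ie).add ir) ig hKc.measurableSet hpt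
  rw [integral_add' (i0.add ie) ir, integral_add' i0 ie, hF0, add_zero, hE] at hmono
  exact hmono

/-! ### The singular time weight. -/

/-- A function of time that blows up at both ends of the interval `(α, β)`. -/
noncomputable def timeWeight (s α β t : ℝ) : ℝ := s / ((t - α) * (β - t))

/-- The derivative of `timeWeight`. -/
noncomputable def timeWeight' (s α β t : ℝ) : ℝ :=
  s * (2 * t - α - β) / ((t - α) * (β - t)) ^ 2

/-- The second derivative of `timeWeight`. -/
noncomputable def timeWeight'' (s α β t : ℝ) : ℝ :=
  s * (2 * ((t - α) * (β - t)) + 2 * (2 * t - α - β) ^ 2) / ((t - α) * (β - t)) ^ 3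

section timeWeight

variable {s α β t : ℝ}

theorem hasDerivAt_quadratic (α β t : ℝ) :
    HasDerivAt (fun τ : ℝ => (τ - α) * (β - τ)) (α + β - 2 * t) t := by
  refine (((hasDerivAt_id' t).sub_const α).fun_mul
    ((hasDerivAt_id' t).const_sub β)).congr_deriv ?_
  ring

theorem hasDerivAt_timeWeight (h : (t - α) * (β - t) ≠ 0) :
    HasDerivAt (timeWeight s α β) (timeWeight' s α β t) t := by
  unfold timeWeight timeWeight'
  refine ((hasDerivAt_const t s).fun_div (hasDerivAt_quadratic α β t) h).congr_deriv ?_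
  ring

theorem hasDerivAt_timeWeight' (h : (t - α) * (β - t) ≠ 0) :
    HasDerivAt (timeWeight' s α β) (timeWeight'' s α β t) t := by
  unfold timeWeight' timeWeight''
  refine ((((((hasDerivAt_id' t).const_mul 2).sub_const α).sub_const β).const_mul s).fun_div
    ((hasDerivAt_quadratic α β t).fun_pow 2) (pow_ne_zero 2 h)).congr_deriv ?_
  generalize hg : (t - α) * (β - t) = g at *
  field_simp
  norm_num
  ring

variable (hα : α < t) (hβ : t < β)
include hα hβ

theorem le_timeWeight {r : ℝ} (hr : 0 ≤ r) (hs : (β - α) ^ 2 * r ≤ s) :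
    r ≤ timeWeight s α β t := by
  have h : 0 < (t - α) * (β - t) := mul_pos (by linarith) (by linarith)
  rw [timeWeight, le_div_iff₀ h]
  refine le_trans ?_ hs
  rw [mul_comm]
  gcongr
  nlinarith

/-- Each time derivative costs one more factor `1 / ((t - α)(β - t))`, hence one more power of the
weight; a large `s` absorbs the numerators. -/
theorem abs_timeWeight'_le (hs : β - α ≤ s) :
    |timeWeight' s α β t| ≤ timeWeight s α β t ^ 2 := by
  have h : 0 < (t - α) * (β - t) := mul_pos (by linarith) (by linarith)
  have hs0 : 0 < s := by linarith
  rw [timeWeight, timeWeight', abs_div, abs_mul, abs_of_pos hs0, abs_of_pos (pow_pos h 2), div_pow]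
  have : |2 * t - α - β| ≤ s := abs_le.2 ⟨by linarith, by linarith⟩
  gcongr
  nlinarith

theorem abs_timeWeight''_le (hs : 2 * (β - α) ≤ s) :
    |timeWeight'' s α β t| ≤ timeWeight s α β t ^ 3 := by
  have h : 0 < (t - α) * (β - t) := mul_pos (by linarith) (by linarith)
  have hs0 : 0 < s := by linarith
  rw [timeWeight'', timeWeight, abs_of_nonneg (by positivity), div_pow]
  have h1 : 2 * ((t - α) * (β - t)) + 2 * (2 * t - α - β) ^ 2 ≤ (2 * (β - α)) ^ 2 := by
    nlinarith
  have h2 : (2 * (β - α)) ^ 2 ≤ s ^ 2 := pow_le_pow_left₀ (by linarith) hs 2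
  gcongr
  calc s * _ ≤ s * s ^ 2 := by gcongr; exact h1.trans h2
    _ = s ^ 3 := by ring

end timeWeight

/-! ### Decay of the energy at the ends of the time interval. -/

/-- Since `ψ ≥ L²/2`, the squared weight contains at most `exp(-m L²) ≤ 4! / (m L²)⁴`. The fourth
power beats the growth `m³` of the energy coefficients by one power. -/
theorem weight_sq_le {L β : ℝ} (hL : 0 < L) {m : ℝ → ℝ} {t x : ℝ} (ht : t ≤ β) (hm : 0 < m t)
    (hx : x ∈ Set.Icc (-L) L) :
    weight L m (t, x) ^ 2 ≤
      Real.exp (2 * L / 3 + 4 * β / 27) * (24 / (L ^ 8 * m t ^ 4)) := by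
  have h1 : Real.exp (-(m t * L ^ 2)) ≤ 24 / (L ^ 8 * m t ^ 4) := by
    have := Real.pow_div_factorial_le_exp (x := m t * L ^ 2) (by positivity) 4
    rw [Real.exp_neg, inv_le_comm₀ (Real.exp_pos _) (by positivity), inv_div]
    refine le_trans (le_of_eq ?_) this
    norm_num [Nat.factorial]
    ring
  refine le_trans ?_ (mul_le_mul_of_nonneg_left h1 (Real.exp_pos _).le)
  rw [weight, ← Real.exp_nat_mul, ← Real.exp_add, Real.exp_le_exp]
  have h2 : L ^ 2 / 2 ≤ 5 * L ^ 2 - (2 * L - x) ^ 2 / 2 := by nlinarith [hx.1, hx.2]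
  have h3 := mul_le_mul_of_nonneg_left h2 hm.le
  simp only [Nat.cast_ofNat]
  linarith [hx.2]

/-- All coefficients are `O(m³)`, using `m ≥ 1` to raise lower powers. The `q₁²` term contributes
`162 L³ + 36 L` and the `q²` term `27 L³ + 5 L² + 3 L`. -/
theorem abs_energyAt_le {L β N : ℝ} (hL : 0 < L) {m m' : ℝ → ℝ} {t x : ℝ} (ht : t ≤ β)
    (hm : 1 ≤ m t) (hm' : |m' t| ≤ m t ^ 2) (hx : x ∈ Set.Icc (-L) L) (φ : 𝓓(Ω, ℝ))
    (h0 : φ (t, x) ^ 2 ≤ N) (h1 : dx φ (t, x) ^ 2 ≤ N) :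
    |energyAt L m m' φ (t, x)| ≤
      (189 * L ^ 3 + 39 * L + 5 * L ^ 2) * (Real.exp (2 * L / 3 + 4 * β / 27) * (24 / L ^ 8)) * N
        / m t := by
  have hm0 : 0 < m t := by linarith
  have hN : 0 ≤ N := (sq_nonneg _).trans h0
  have hw := weight_sq_le (m := m) hL ht hm0 hx
  have hy : L ≤ 2 * L - x := by linarith [hx.2]
  have hy' : 2 * L - x ≤ 3 * L := by linarith [hx.1]
  simp only [energyAt, energyDensity, conj₀, conj₁]
  set w := weight L m (t, x)
  set y := 2 * L - x
  set p := φ (t, x)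
  set p₁ := dx φ (t, x)
  set k := m t
  have hu : 0 ≤ k * y := mul_nonneg hm0.le (hL.le.trans hy)
  have hu' : k * y ≤ 3 * L * k := by nlinarith
  have hψ : |5 * L ^ 2 - y ^ 2 / 2| ≤ 5 * L ^ 2 := abs_le.2 ⟨by nlinarith, by nlinarith⟩
  have hc : |(k * y) ^ 3 + m' t * (5 * L ^ 2 - y ^ 2 / 2) - k * y / 3| ≤
      27 * L ^ 3 * k ^ 3 + 5 * L ^ 2 * k ^ 3 + 3 * L * k ^ 3 := by
    have e1 : (k * y) ^ 3 ≤ (3 * L * k) ^ 3 := pow_le_pow_left₀ hu hu' 3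
    have e2 : |m' t * (5 * L ^ 2 - y ^ 2 / 2)| ≤ k ^ 3 * (5 * L ^ 2) := by
      rw [abs_mul]
      exact mul_le_mul (hm'.trans (pow_le_pow_right₀ hm (by norm_num))) hψ (abs_nonneg _)
        (by positivity)
    have e3 : k * y / 3 ≤ 3 * L * k ^ 3 := by
      have : k ≤ k ^ 3 := le_self_pow₀ hm (by norm_num)
      nlinarith
    have e4 : 0 ≤ (k * y) ^ 3 := by positivity
    have e5 : 0 ≤ 27 * L ^ 3 * k ^ 3 := by positivity
    rw [abs_le] at e2 ⊢
    constructor <;> nlinarith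
  have hb : (p₁ - (k * y - 1 / 3) * p) ^ 2 ≤ 2 * (2 + (k * y) ^ 2) * N := by
    have e1 : (k * y - 1 / 3) ^ 2 ≤ (k * y) ^ 2 + 1 := by nlinarith
    have e2 : ((k * y - 1 / 3) * p) ^ 2 ≤ ((k * y) ^ 2 + 1) * N := by
      rw [mul_pow]
      exact mul_le_mul e1 h0 (sq_nonneg _) (by positivity)
    nlinarith [sq_nonneg (p₁ + (k * y - 1 / 3) * p)]
  have hd : 3 * (k * y) * (2 * (2 + (k * y) ^ 2) * N) ≤
      (36 * L * k ^ 3 + 162 * L ^ 3 * k ^ 3) * N := by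
    have e1 : (k * y) ^ 3 ≤ (3 * L * k) ^ 3 := pow_le_pow_left₀ hu hu' 3
    have e2 : k ≤ k ^ 3 := le_self_pow₀ hm (by norm_num)
    have e3 : k * y ≤ 3 * L * k ^ 3 := hu'.trans (by gcongr)
    have e4 : 3 * (k * y) * (2 * (2 + (k * y) ^ 2)) ≤ 36 * L * k ^ 3 + 162 * L ^ 3 * k ^ 3 := by
      nlinarith
    nlinarith
  have key : |-3 * (k * y) * (p₁ - (k * y - 1 / 3) * p) ^ 2
      + ((k * y) ^ 3 + m' t * (5 * L ^ 2 - y ^ 2 / 2) - k * y / 3) * p ^ 2| ≤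
      (189 * L ^ 3 + 39 * L + 5 * L ^ 2) * k ^ 3 * N := by
    refine (abs_add_le _ _).trans ?_
    rw [abs_mul (-3 * (k * y)), abs_mul (-3) (k * y), abs_mul _ (p ^ 2), abs_of_nonneg hu,
      abs_of_nonneg (sq_nonneg (p₁ - _)),
      abs_of_nonneg (sq_nonneg p)]
    have f1 : |(-3 : ℝ)| * (k * y) * (p₁ - (k * y - 1 / 3) * p) ^ 2 ≤
        3 * (k * y) * (2 * (2 + (k * y) ^ 2) * N) := by
      norm_num
      gcongr
    have f2 := mul_le_mul hc h0 (sq_nonneg _) (by positivity)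
    linarith
  calc _ = w ^ 2 * |-3 * (k * y) * (p₁ - (k * y - 1 / 3) * p) ^ 2
        + ((k * y) ^ 3 + m' t * (5 * L ^ 2 - y ^ 2 / 2) - k * y / 3) * p ^ 2| := by
        rw [← abs_of_nonneg (sq_nonneg w), abs_sq, ← abs_sq w, ← abs_mul]
        congr 1
        ring
    _ ≤ (Real.exp (2 * L / 3 + 4 * β / 27) * (24 / (L ^ 8 * k ^ 4))) *
        ((189 * L ^ 3 + 39 * L + 5 * L ^ 2) * k ^ 3 * N) :=
        mul_le_mul hw key (abs_nonneg _) (by positivity)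
    _ = _ := by field_simp

theorem exists_sq_bound (φ : 𝓓(Ω, ℝ)) : ∃ N, ∀ z, φ z ^ 2 ≤ N := by
  obtain ⟨C, hC⟩ := φ.hasCompactSupport.exists_bound_of_continuous φ.continuous
  refine ⟨C ^ 2, fun z => ?_⟩
  rw [← sq_abs]
  exact pow_le_pow_left₀ (abs_nonneg _) (hC z) 2

theorem le_of_forall_small_le_add_mul {X Y R ε : ℝ} (hε : 0 < ε)
    (h : ∀ η, 0 < η → η ≤ ε → X ≤ Y + η * R) : X ≤ Y := by
  have ht : Filter.Tendsto (fun η : ℝ => Y + η * R) (𝓝[>] 0) (𝓝 Y) := by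
    have : ContinuousAt (fun η : ℝ => Y + η * R) 0 := by fun_prop
    simpa using this.tendsto.mono_left nhdsWithin_le_nhds
  refine ge_of_tendsto ht ?_
  filter_upwards [Ioc_mem_nhdsGT hε] with η hη using h η hη.1 hη.2

/-! ### Observability. -/

/-- The weighted estimate: the boundary terms at both ends of the time interval vanish. -/
theorem weighted_observability {L α β s ε : ℝ} (hL : 0 < L) (hε : 0 < ε)
    (hεT : 2 * ε ≤ β - α) (hs : (β - α) ^ 2 * (1 + 4 / L + 1 / L ^ 2) ≤ s)
    (hs' : 2 * (β - α) ≤ s) {k : ℝ} (hk : ∀ z ∈ Set.Icc α β ×ˢ Set.Icc (-L) L,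
      z.1 ∈ Set.Ioo α β → weight L (timeWeight s α β) z ^ 2 ≤ k) (φ : 𝓓(strip L, ℝ)) :
    ∫ z in Set.Icc (α + ε) (β - ε) ×ˢ Set.Icc (-L) L, (weight L (timeWeight s α β) z * φ z) ^ 2
      ≤ k * ∫ z in Set.Icc α β ×ˢ Set.Icc (-L) L, adj φ z ^ 2 := by
  have hs0 : 0 < s := by linarith
  have hT : 0 < β - α := by linarith
  set m := timeWeight s α β with hmdef
  have hbd : ∀ t ∈ Set.Ioo α β, 1 + 4 / L + 1 / L ^ 2 ≤ m t := fun t ht =>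
    le_timeWeight ht.1 ht.2 (by positivity) hs
  have hp1 : 0 < 4 / L := by positivity
  have hp2 : 0 < 1 / L ^ 2 := by positivity
  have h1 : ∀ t ∈ Set.Ioo α β, 1 ≤ m t := fun t ht => by linarith [hbd t ht]
  have h2 : ∀ t ∈ Set.Ioo α β, 4 ≤ m t * L := fun t ht => by
    rw [← div_le_iff₀ hL]; linarith [hbd t ht]
  have h3 : ∀ t ∈ Set.Ioo α β, 1 ≤ m t * L ^ 2 := fun t ht => by
    rw [← div_le_iff₀ (by positivity)]; linarith [hbd t ht]
  have hne : ∀ t ∈ Set.Ioo α β, (t - α) * (β - t) ≠ 0 := fun t ht =>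
    (mul_pos (sub_pos.2 ht.1) (sub_pos.2 ht.2)).ne'
  obtain ⟨N₀, hN₀⟩ := exists_sq_bound φ
  obtain ⟨N₁, hN₁⟩ := exists_sq_bound (dx φ)
  set N := max N₀ N₁
  have hN : 0 ≤ N := ((sq_nonneg _).trans (hN₀ 0)).trans (le_max_left _ _)
  set D := (189 * L ^ 3 + 39 * L + 5 * L ^ 2) * (Real.exp (2 * L / 3 + 4 * β / 27) * (24 / L ^ 8))
    * N with hD
  have hD0 : 0 ≤ D := by positivity
  have hen : ∀ t ∈ Set.Ioo α β, ∀ x ∈ Set.Icc (-L) L,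
      |energyAt L m (timeWeight' s α β) φ (t, x)| ≤ D / m t := fun t ht x hx =>
    abs_energyAt_le hL ht.2.le (h1 t ht) (abs_timeWeight'_le ht.1 ht.2 (by linarith)) hx φ
      ((hN₀ _).trans (le_max_left _ _)) ((hN₁ _).trans (le_max_right _ _))
  -- The Carleman inequality is used on `[α + η, β - η]`. Each end energy is at most `D η (β - α) /
  -- s`; two ends and length `2L` give `η R`.
  refine le_of_forall_small_le_add_mul (R := 4 * L * D * (β - α) / s) hε fun η hη hηε => ?_
  have hsub : Set.Icc (α + η) (β - η) ⊆ Set.Ioo α β := fun t ht =>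
    ⟨by linarith [ht.1], by linarith [ht.2]⟩
  have hc : α + η ∈ Set.Ioo α β := ⟨by linarith, by linarith⟩
  have hd : β - η ∈ Set.Ioo α β := ⟨by linarith, by linarith⟩
  have hcont : ContinuousOn (timeWeight'' s α β) (Set.Icc (α + η) (β - η)) := by
    unfold timeWeight''
    exact ContinuousOn.div (by fun_prop) (by fun_prop) fun t ht => pow_ne_zero 3 (hne t (hsub ht))
  have hcarl := carleman_integral hL (c := α + η) (d := β - η) (by linarith)
    (fun t ht => hasDerivAt_timeWeight (s := s) (hne t (hsub ht)))
    (fun t ht => hasDerivAt_timeWeight' (s := s) (hne t (hsub ht))) hcont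
    (fun t ht => h1 t (hsub ht)) (fun t ht => h2 t (hsub ht)) (fun t ht => h3 t (hsub ht))
    (fun t ht => abs_timeWeight'_le (hsub ht).1 (hsub ht).2 (by linarith))
    (fun t ht => abs_timeWeight''_le (hsub ht).1 (hsub ht).2 hs') φ
  have hinv : ∀ t, (t - α) * (β - t) = η * (β - α - η) → D / m t ≤ D * (η * (β - α) / s) := by
    intro t ht
    rw [hmdef, timeWeight, ht, div_eq_mul_inv, inv_div]
    refine mul_le_mul_of_nonneg_left (div_le_div_of_nonneg_right ?_ hs0.le) hD0
    exact mul_le_mul_of_nonneg_left (by linarith) hη.le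
  have hbdry : |∫ x in Set.Icc (-L) L, (energyAt L m (timeWeight' s α β) φ (β - η, x)
      - energyAt L m (timeWeight' s α β) φ (α + η, x))| ≤ η * (4 * L * D * (β - α) / s) := by
    have hb := norm_setIntegral_le_of_norm_le_const (μ := volume) (s := Set.Icc (-L) L)
      (C := 2 * (D * (η * (β - α) / s)))
      (f := fun x => energyAt L m (timeWeight' s α β) φ (β - η, x)
        - energyAt L m (timeWeight' s α β) φ (α + η, x)) (by simp) (fun x hx => by
        refine (abs_sub _ _).trans ?_
        linarith [hen _ hd x hx, hen _ hc x hx, hinv (β - η) (by ring), hinv (α + η) (by ring)])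
    refine hb.trans (le_of_eq ?_)
    rw [Real.volume_real_Icc_of_le (by linarith)]
    ring
  have cm : ContinuousOn (fun z : ℝ × ℝ => m z.1)
      (Set.Icc (α + η) (β - η) ×ˢ Set.Icc (-L) L) :=
    ContinuousOn.comp (g := m) (t := Set.Icc (α + η) (β - η)) (fun t ht =>
        (hasDerivAt_timeWeight (hne t (hsub ht))).continuousAt.continuousWithinAt)
      continuous_fst.continuousOn fun z hz => hz.1
  have hKc : IsCompact (Set.Icc (α + η) (β - η) ×ˢ Set.Icc (-L) L) :=
    isCompact_Icc.prod isCompact_Icc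
  obtain ⟨cw, c0, -⟩ := continuousOn_conj_spatial (L := L) φ cm
  have hleft : ∫ z in Set.Icc (α + ε) (β - ε) ×ˢ Set.Icc (-L) L, (weight L m z * φ z) ^ 2 ≤
      ∫ z in Set.Icc (α + η) (β - η) ×ˢ Set.Icc (-L) L, (weight L m z * φ z) ^ 2 := by
    refine setIntegral_mono_set ((c0.pow 2).integrableOn_compact hKc)
      (Filter.Eventually.of_forall fun z => sq_nonneg _) (LE.le.eventuallyLE ?_)
    exact Set.prod_mono (Set.Icc_subset_Icc (by linarith) (by linarith)) subset_rfl
  have hint : ∀ K : Set (ℝ × ℝ), IsCompact K → IntegrableOn (fun z => k * adj φ z ^ 2) K :=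
    fun K hK => (Continuous.continuousOn
      (((adj φ).continuous.pow 2).const_mul k)).integrableOn_compact hK
  have hk0 : 0 ≤ k := (sq_nonneg _).trans
    (hk (α + η, 0) ⟨⟨hc.1.le, hc.2.le⟩, by simp [hL.le]⟩ hc)
  have hright : ∫ z in Set.Icc (α + η) (β - η) ×ˢ Set.Icc (-L) L, (weight L m z * adj φ z) ^ 2 ≤
      k * ∫ z in Set.Icc α β ×ˢ Set.Icc (-L) L, adj φ z ^ 2 := by
    rw [← integral_const_mul]
    refine (setIntegral_mono_on (((cw.mul (adj φ).continuous.continuousOn).pow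
      2).integrableOn_compact hKc) (hint _ hKc) hKc.measurableSet fun z hz => ?_).trans
      (setIntegral_mono_set (hint _ (isCompact_Icc.prod isCompact_Icc))
        (Filter.Eventually.of_forall fun z => by positivity) (LE.le.eventuallyLE ?_))
    · simp only [Pi.pow_apply, Pi.mul_apply, mul_pow]
      gcongr
      exact hk z ⟨⟨(hsub hz.1).1.le, (hsub hz.1).2.le⟩, hz.2⟩ (hsub hz.1)
    · exact Set.prod_mono (fun t ht => ⟨(hsub ht).1.le, (hsub ht).2.le⟩) subset_rfl
  linarith [(abs_le.1 hbdry).1]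

/-- The observability inequality: test functions are controlled on a time interval by the
transposed operator on a slightly larger one. -/
theorem observability {L t₁ t₂ ε : ℝ} (hL : 0 < L) (ht : t₁ < t₂) (hε : 0 < ε) :
    ∃ C : ℝ, 0 < C ∧ ∀ φ : 𝓓(strip L, ℝ),
      ∫ z in Set.Icc t₁ t₂ ×ˢ Set.Icc (-L) L, φ z ^ 2 ≤
        C * ∫ z in Set.Icc (t₁ - ε) (t₂ + ε) ×ˢ Set.Icc (-L) L, adj φ z ^ 2 := by
  set α := t₁ - ε with hα
  set β := t₂ + ε with hβ
  have hαβ : α < β := by linarith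
  set s := (β - α) ^ 2 * (1 + 4 / L + 1 / L ^ 2) + 2 * (β - α) with hs
  have hs0 : 0 < s := by
    have : 0 < β - α := by linarith
    positivity
  set m := timeWeight s α β with hm
  -- Here `k` bounds the squared weight above on `(α, β)` (drop `mψ ≥ 0`), and `l` bounds it below
  -- on `[t₁, t₂]`, where `m ≤ s / ε²` and `ψ ≤ 5L²`.
  set k := Real.exp (L / 3 + 2 * β / 27) ^ 2 with hk
  set l := Real.exp (-(5 * L ^ 2 * (s / ε ^ 2) + L / 3 - 2 * t₁ / 27)) ^ 2 with hl
  have hl0 : 0 < l := by positivity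
  refine ⟨k / l, by positivity, fun φ => ?_⟩
  have hweighted := weighted_observability (α := α) (β := β) hL hε (by linarith) (s := s)
    (by linarith) (by rw [hs]; exact le_add_of_nonneg_left (by positivity)) (k := k)
    (fun z hz hz' => by
      refine pow_le_pow_left₀ (Real.exp_pos _).le (Real.exp_le_exp.2 ?_) 2
      have h1 : 0 ≤ timeWeight s α β z.1 := div_nonneg hs0.le
        (mul_pos (sub_pos.2 hz'.1) (sub_pos.2 hz'.2)).le
      have h2 : 0 ≤ 5 * L ^ 2 - (2 * L - z.2) ^ 2 / 2 := by nlinarith [hz.2.1, hz.2.2]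
      linarith [mul_nonneg h1 h2, hz.2.2, hz'.2]) φ
  rw [show α + ε = t₁ by ring, show β - ε = t₂ by ring] at hweighted
  rw [div_mul_eq_mul_div, le_div_iff₀ hl0, mul_comm]
  refine le_trans ?_ hweighted
  have hKc : IsCompact (Set.Icc t₁ t₂ ×ˢ Set.Icc (-L) L) := isCompact_Icc.prod isCompact_Icc
  have hpos : ∀ t ∈ Set.Icc t₁ t₂, ε ^ 2 ≤ (t - α) * (β - t) := fun t ht => by
    rw [sq]
    exact mul_le_mul (by linarith [ht.1]) (by linarith [ht.2]) hε.le (by linarith [ht.1])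
  have cm : ContinuousOn (fun z : ℝ × ℝ => m z.1) (Set.Icc t₁ t₂ ×ˢ Set.Icc (-L) L) :=
    ContinuousOn.comp (g := m) (t := Set.Icc t₁ t₂) (fun t ht => (hasDerivAt_timeWeight
        ((pow_pos hε 2).trans_le (hpos t ht)).ne').continuousAt.continuousWithinAt)
      continuous_fst.continuousOn fun z hz => hz.1
  rw [← integral_const_mul]
  refine setIntegral_mono_on ((Continuous.continuousOn
      ((φ.continuous.pow 2).const_mul l)).integrableOn_compact hKc)
    (((continuousOn_conj_spatial (L := L) φ cm).2.1.pow 2).integrableOn_compact hKc)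
    hKc.measurableSet fun z hz => ?_
  rw [mul_pow]
  refine mul_le_mul_of_nonneg_right ?_ (sq_nonneg _)
  refine pow_le_pow_left₀ (Real.exp_pos _).le (Real.exp_le_exp.2 (neg_le_neg ?_)) 2
  have h1 : m z.1 ≤ s / ε ^ 2 :=
    div_le_div_of_nonneg_left hs0.le (by positivity) (hpos _ hz.1)
  have h2 : 0 ≤ 5 * L ^ 2 - (2 * L - z.2) ^ 2 / 2 := by nlinarith [hz.2.1, hz.2.2]
  have h3 : m z.1 * (5 * L ^ 2 - (2 * L - z.2) ^ 2 / 2) ≤ s / ε ^ 2 * (5 * L ^ 2) :=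
    mul_le_mul h1 (by nlinarith [sq_nonneg (2 * L - z.2)]) h2 (by positivity)
  linarith [hz.2.1, hz.1.1]

/-! ### Test functions cut off in time, as elements of `L²`. -/

theorem memLp_indicator_testFunction {W : Set (ℝ × ℝ)} (hW : MeasurableSet W) (ψ : 𝓓(Ω, ℝ)) :
    MemLp (W.indicator ψ) 2 ((volume : Measure (ℝ × ℝ)).restrict (Ω : Set (ℝ × ℝ))) :=
  ((ψ.continuous.memLp_of_hasCompactSupport ψ.hasCompactSupport).restrict _).indicator hW

/-- The class in `L²(Ω)` of a test function cut off to a measurable set. -/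
noncomputable def cutoff {W : Set (ℝ × ℝ)} (hW : MeasurableSet W) : 𝓓(Ω, ℝ) →ₗ[ℝ] L2 Ω where
  toFun ψ := (memLp_indicator_testFunction hW ψ).toLp _
  map_add' ψ χ := by
    rw [← MemLp.toLp_add]
    exact MemLp.toLp_congr _ _ (Filter.Eventually.of_forall fun z =>
      congrFun (Set.indicator_add W ψ χ) z)
  map_smul' c ψ := by
    rw [RingHom.id_apply, ← MemLp.toLp_const_smul]
    exact MemLp.toLp_congr _ _ (Filter.Eventually.of_forall fun z =>
      congrFun (Set.indicator_const_smul W c ψ) z)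

theorem cutoff_ae_eq {W : Set (ℝ × ℝ)} (hW : MeasurableSet W) (ψ : 𝓓(Ω, ℝ)) :
    cutoff hW ψ =ᵐ[(volume : Measure (ℝ × ℝ)).restrict (Ω : Set (ℝ × ℝ))] W.indicator ψ :=
  (memLp_indicator_testFunction hW ψ).coeFn_toLp

theorem inner_cutoff {W : Set (ℝ × ℝ)} (hW : MeasurableSet W) (u : L2 Ω) (ψ : 𝓓(Ω, ℝ)) :
    inner ℝ u (cutoff hW ψ) = ∫ z in (Ω : Set (ℝ × ℝ)), W.indicator ψ z * u z := by
  rw [L2.inner_def]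
  refine integral_congr_ae ?_
  filter_upwards [cutoff_ae_eq hW ψ] with z hz
  rw [hz]
  simp

theorem norm_cutoff_sq {L c d : ℝ} (ψ : 𝓓(strip L, ℝ)) :
    ‖cutoff (W := Set.Icc c d ×ˢ Set.univ) (measurableSet_Icc.prod .univ) ψ‖ ^ 2 =
      ∫ z in Set.Icc c d ×ˢ Set.Icc (-L) L, ψ z ^ 2 := by
  set W : Set (ℝ × ℝ) := Set.Icc c d ×ˢ Set.univ with hWdef
  have hW : MeasurableSet W := measurableSet_Icc.prod .univ
  have h : (∫ z in (strip L : Set (ℝ × ℝ)), W.indicator ψ z * cutoff hW ψ z) =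
      ∫ z in (strip L : Set (ℝ × ℝ)), W.indicator (fun z => ψ z ^ 2) z := by
    refine integral_congr_ae ?_
    filter_upwards [cutoff_ae_eq hW ψ] with z hz
    rw [hz]
    by_cases hz : z ∈ W <;> simp [hz, sq]
  rw [← real_inner_self_eq_norm_sq, inner_cutoff, h, setIntegral_indicator hW]
  refine (setIntegral_eq_of_subset_of_forall_sdiff_eq_zero
    (measurableSet_Icc.prod measurableSet_Icc)
    (fun z hz => ⟨hz.2.1, Set.Ioo_subset_Icc_self hz.1.2⟩) fun z hz => ?_).symm
  have hz' : z ∉ strip L := fun h => hz.2 ⟨h, hz.1.1, trivial⟩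
  rw [testFunction_eq_zero_of_notMem ψ hz', zero_pow two_ne_zero]

end KdVBurgers

/-! ### Solving the equation by duality. -/

open KdVBurgers in
theorem mainTheorem9 (L t₁ t₂ ε : ℝ) (hL : 0 < L) (ht : t₁ < t₂) (hε : 0 < ε) :
    ∃ C : ℝ, 0 < C ∧ ∀ f : KdVBurgers.L2 (KdVBurgers.strip L),
      KdVBurgers.supportIn (KdVBurgers.strip L) f ⊆ Set.Icc t₁ t₂ ×ˢ Set.Ioo (-L) L →
      ∃ v : KdVBurgers.L2 (KdVBurgers.strip L),
        KdVBurgers.P (KdVBurgers.toDistribution v) = KdVBurgers.toDistribution f ∧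
        KdVBurgers.supportIn (KdVBurgers.strip L) v ⊆
          Set.Icc (t₁ - ε) (t₂ + ε) ×ˢ Set.Ioo (-L) L ∧
        ‖v‖ ≤ C * ‖f‖ := by
  obtain ⟨C, hC, hobs⟩ := observability hL ht hε
  refine ⟨√C, Real.sqrt_pos.2 hC, fun f hf => ?_⟩
  have hW₁ : MeasurableSet (Set.Icc t₁ t₂ ×ˢ (Set.univ : Set ℝ)) := measurableSet_Icc.prod .univ
  have hW : MeasurableSet (Set.Icc (t₁ - ε) (t₂ + ε) ×ˢ (Set.univ : Set ℝ)) :=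
    measurableSet_Icc.prod .univ
  have hf0 := ae_eq_zero_of_supportIn_subset hf
  have hfφ : ∀ φ : 𝓓(strip L, ℝ), toDistribution f φ = inner ℝ f (cutoff hW₁ φ) := by
    intro φ
    rw [toDistribution_apply, inner_cutoff]
    refine integral_congr_ae ?_
    filter_upwards [hf0] with z hz
    by_cases hzW : z ∈ Set.Icc t₁ t₂ ×ˢ (Set.univ : Set ℝ)
    · rw [Set.indicator_of_mem hzW]
    · rw [hz fun h => hzW ⟨h.1, trivial⟩, mul_zero, mul_zero]
  have hbound : ∀ φ : 𝓓(strip L, ℝ), ‖cutoff hW₁ φ‖ ≤ √C * ‖cutoff hW (adj φ)‖ := by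
    intro φ
    refine abs_le_of_sq_le_sq' ?_ (by positivity) |>.2
    rw [mul_pow, Real.sq_sqrt hC.le, norm_cutoff_sq, norm_cutoff_sq]
    exact hobs φ
  -- The minus sign matches `P_apply`.
  obtain ⟨w, hw, hwT⟩ := exists_inner_eq_of_abs_le ((cutoff hW).comp adjₗ)
    (-(toDistribution f).toLinearMap) (√C * ‖f‖) (by positivity) (fun φ => by
      change |-(toDistribution f φ)| ≤ √C * ‖f‖ * ‖cutoff hW (adj φ)‖
      rw [abs_neg, hfφ]
      calc _ ≤ ‖f‖ * ‖cutoff hW₁ φ‖ := abs_real_inner_le_norm _ _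
        _ ≤ ‖f‖ * (√C * ‖cutoff hW (adj φ)‖) := by gcongr; exact hbound φ
        _ = _ := by ring)
  -- Only pairings of `w` with functions cut off to the larger slab matter, so truncating `w` to
  -- that slab keeps the equation, does not increase the norm and localizes the support.
  have hmem := (Lp.memLp w).indicator hW
  have hv := hmem.coeFn_toLp
  refine ⟨hmem.toLp _, ?_, ?_, ?_⟩
  · ext φ
    rw [P_apply, toDistribution_apply]
    have h := hwT φ
    change inner ℝ w (cutoff hW (adj φ)) = -(toDistribution f φ) at h
    rw [← neg_eq_iff_eq_neg] at h
    rw [← h, inner_cutoff, neg_inj]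
    refine integral_congr_ae ?_
    filter_upwards [hv] with z hz
    rw [hz]
    by_cases hzW : z ∈ Set.Icc (t₁ - ε) (t₂ + ε) ×ˢ (Set.univ : Set ℝ) <;> simp [hzW]
  -- The slab is taken over all `x` so as to be closed in the plane; the restriction to `(-L, L)`
  -- comes from the support lying in the strip.
  · have hsupp := supportIn_subset_of_ae_eq_zero (Ω := strip L) (u := hmem.toLp _)
      (isClosed_Icc.prod isClosed_univ) (hv.mono fun z hz hzW => by
        rw [hz, Set.indicator_of_notMem hzW])
    exact fun z hz => ⟨(hsupp hz).1, hz.1.2⟩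
  · refine le_trans (Lp.norm_le_norm_of_ae_le ?_) hw
    filter_upwards [hv] with z hz
    rw [hz]
    exact norm_indicator_le_norm_self _ _
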